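/- Let $K$ be a field and let $(\Sigma,\preceq)$ be a nonempty partially ordered set such that (1) for every $\tau\in\Sigma$ the set $\{\sigma\in\Sigma:\sigma\preceq\tau\}$ is finite and totally ordered, and (2) every $\sigma\in\Sigma$ is the immediate predecessor of two incomparable elements of $\Sigma$. Let $\Sigma_+$ be the set of nonminimal elements; each $\tau\in\Sigma_+$ has a unique immediate predecessor $\tau_-$. Write $\sigma\prec_{\mathrm{im}}\tau$ if $\sigma=\tau_-$. Let $R=K[X_\sigma:\sigma\in\Sigma_+]/(X_\sigma X_\tau : \sigma,\tau\in\Sigma_+ \text{ incomparable})$ and let $x_\sigma$ be the image of $X_\sigma$. Let $M$ be the quotient of the free $R$-module with basis $\{U_\sigma:\sigma\in\Sigma\}$ by the submodule spanned by all $U_{\tau_-}-x_\tau U_\tau$, $\tau\in\Sigma_+$, and let $u_\sigma$ be the image of $U_\sigma$. Both $R$ and $M$ are multigraded by the free abelian group $\mathbb{Z}^{\oplus\Sigma}$ on $\Sigma$: $x_\sigma$ has degree $\sigma$ and $u_\sigma$ has degree $-\sum_{\rho\preceq\sigma}\rho$. Then the following hold. (a) If $\sigma\in\Sigma_+$, $\tau\in\Sigma$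 and $\sigma\not\preceq\tau$, then $x_\sigma u_\tau=0$. Moreover $x_\sigma^2u_\sigma=0$ for all $\sigma\in\Sigma_+$. (b) If $\tau_{k-1}\prec_{\mathrm{im}}\tau_k\prec_{\mathrm{im}}\cdots\prec_{\mathrm{im}}\tau_n$ in $\Sigma$ with $k\le n$, and $a_k,\dots,a_n$ are positive integers, then $x_{\tau_k}^{a_k}\cdots x_{\tau_n}^{a_n}u_{\tau_n}$ is $0$ if some $a_i\ge 2$, and equals $u_{\tau_{k-1}}$ if $a_k=\cdots=a_n=1$. (c) For every $\tau\in\Sigma$, the annihilator of $u_\tau$ in $R$ is the ideal generated by all $x_\sigma$ with $\sigma\in\Sigma_+$, $\sigma\not\preceq\tau$, and all products $x_{\tau_k}^2x_{\tau_{k+1}}\cdots x_{\tau_n}$ with $\tau_k\prec_{\mathrm{im}}\tau_{k+1}\prec_{\mathrm{im}}\cdots\prec_{\mathrm{im}}\tau_n=\tau$ in $\Sigma_+$ and $k\le n$. (d) The products $\mu u_\tau$, where $\tau\in\Sigma$ and $\mu$ is a monomial in the variables $x_\sigma$ with $\sigma\in\Sigma_+$, $\sigma\prec\tau$, form a $K$-basis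 of $M$ (indexed by the pairs $(\tau,\mu)$). Each of these basis elements is multihomogeneous, and their multidegrees are mutually distinct. (e) $PM=M$ for every minimal prime $P$ of $R$. Moreover, $(\mathrm{Ann}_R\,u_\sigma)M=M$ for every $\sigma\in\Sigma$, whereas $(\mathrm{Ann}_R\,x_\sigma)M\neq M$ for every $\sigma\in\Sigma_+$. (f) $M$ is not flat over $R$. -/

import Mathlib

/-- The posets of the construction: nonempty, every principal lower set is finite and totally
ordered, and every element is the immediate predecessor of two incomparable elements. -/
structure IsBranchingForest (S : Type*) [PartialOrder S] : Prop where
  nonempty : Nonempty S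
  finite_below : ∀ τ : S, {σ : S | σ ≤ τ}.Finite
  total_below : ∀ τ σ σ' : S, σ ≤ τ → σ' ≤ τ → σ ≤ σ' ∨ σ' ≤ σ
  branches : ∀ σ : S, ∃ τ τ' : S, ¬ τ ≤ τ' ∧ ¬ τ' ≤ τ ∧ σ ⋖ τ ∧ σ ⋖ τ'

/-- The set `S₊` of nonminimal elements. -/
abbrev NonMin (S : Type*) [PartialOrder S] : Type _ := {σ : S // ¬ IsMin σ}

/-- The ideal generated by all `X_σ X_τ` with `σ`, `τ` incomparable. -/
noncomputable def incompIdeal (K S : Type*) [Field K] [PartialOrder S] : Ideal (MvPolynomial (NonMin S) K) :=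
  Ideal.span {f | ∃ σ τ : NonMin S, ¬ σ.1 ≤ τ.1 ∧ ¬ τ.1 ≤ σ.1 ∧
    f = MvPolynomial.X σ * MvPolynomial.X τ}

/-- The ring `R = K[X_σ : σ ∈ S₊] / (X_σ X_τ : σ, τ incomparable)`. -/
def ForestRing (K S : Type*) [Field K] [PartialOrder S] : Type _ :=
  MvPolynomial (NonMin S) K ⧸ incompIdeal K S

noncomputable instance (K S : Type*) [Field K] [PartialOrder S] : CommRing (ForestRing K S) :=
  inferInstanceAs (CommRing (MvPolynomial (NonMin S) K ⧸ incompIdeal K S))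

noncomputable instance (K S : Type*) [Field K] [PartialOrder S] : Algebra K (ForestRing K S) :=
  inferInstanceAs (Algebra K (MvPolynomial (NonMin S) K ⧸ incompIdeal K S))

/-- The quotient map `K[X_σ : σ ∈ S₊] → R`. -/
noncomputable def ForestRing.proj (K S : Type*) [Field K] [PartialOrder S] :
    MvPolynomial (NonMin S) K →ₐ[K] ForestRing K S :=
  Ideal.Quotient.mkₐ K (incompIdeal K S)

/-- The monomial `∏ x_σ ^ (m σ)` in `R`. -/
noncomputable def ForestRing.mon (K : Type*) {S : Type*} [Field K] [PartialOrder S]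
    (m : NonMin S →₀ ℕ) : ForestRing K S :=
  ForestRing.proj K S (MvPolynomial.monomial m 1)

/-- The image `x_σ` of the variable `X_σ` in `R`. -/
noncomputable def ForestRing.x (K : Type*) {S : Type*} [Field K] [PartialOrder S]
    (σ : NonMin S) : ForestRing K S :=
  ForestRing.proj K S (MvPolynomial.X σ)

/-- The submodule of the free `R`-module on `{U_σ : σ ∈ S}` spanned by all `U_σ - x_τ U_τ`
with `σ = τ₋`. -/
noncomputable def forestRelations (K S : Type*) [Field K] [PartialOrder S] :
    Submodule (ForestRing K S) (S →₀ ForestRing K S) :=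
  Submodule.span (ForestRing K S) {v | ∃ (σ : S) (τ : NonMin S), σ ⋖ τ.1 ∧
    v = Finsupp.single σ 1 - ForestRing.x K τ • Finsupp.single τ.1 1}

/-- The `R`-module `M`. -/
def ForestModule (K S : Type*) [Field K] [PartialOrder S] : Type _ :=
  (S →₀ ForestRing K S) ⧸ forestRelations K S

noncomputable instance (K S : Type*) [Field K] [PartialOrder S] :
    AddCommGroup (ForestModule K S) :=
  inferInstanceAs (AddCommGroup ((S →₀ ForestRing K S) ⧸ forestRelations K S))

noncomputable instance (K S : Type*) [Field K] [PartialOrder S] :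
    Module (ForestRing K S) (ForestModule K S) :=
  inferInstanceAs (Module (ForestRing K S) ((S →₀ ForestRing K S) ⧸ forestRelations K S))

/-- The `K`-vector space structure of `M`, by restriction of scalars along `K → R`. -/
noncomputable instance (K S : Type*) [Field K] [PartialOrder S] : Module K (ForestModule K S) :=
  Module.compHom (ForestModule K S) (algebraMap K (ForestRing K S))

instance (K S : Type*) [Field K] [PartialOrder S] :
    IsScalarTower K (ForestRing K S) (ForestModule K S) :=
  IsScalarTower.of_algebraMap_smul fun _ _ => rfl

/-- The quotient map from the free module to `M`. -/
noncomputable def ForestModule.proj (K S : Type*) [Field K] [PartialOrder S] :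
    (S →₀ ForestRing K S) →ₗ[ForestRing K S] ForestModule K S :=
  (forestRelations K S).mkQ

/-- The image `u_σ` of the free generator `U_σ` in `M`. -/
noncomputable def ForestModule.u (K : Type*) {S : Type*} [Field K] [PartialOrder S] (σ : S) :
    ForestModule K S :=
  ForestModule.proj K S (Finsupp.single σ 1)

/-- The multidegree, in the free abelian group on `S`, of `∏ x_σ ^ (m σ) • u_τ`:
`x_σ` has degree `σ`, and `u_τ` has degree `- ∑_{ρ ≤ τ} ρ`. -/
noncomputable def multidegree {S : Type*} [PartialOrder S] (m : NonMin S →₀ ℕ) (τ : S) :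
    S →₀ ℤ :=
  (m.sum fun σ n => Finsupp.single σ.1 (n : ℤ)) -
    ∑ᶠ ρ ∈ {ρ : S | ρ ≤ τ}, Finsupp.single ρ (1 : ℤ)

/-- The homogeneous component of `M` of multidegree `d`: the image of the corresponding component
of the free module, that is, the `K`-span of the products of monomials of `R` and generators `u_τ`
which have multidegree `d`. -/
noncomputable def ForestModule.component (K : Type*) {S : Type*} [Field K] [PartialOrder S]
    (d : S →₀ ℤ) : Submodule K (ForestModule K S) :=
  Submodule.span K {y | ∃ (m : NonMin S →₀ ℕ) (τ : S), multidegree m τ = d ∧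
    y = ForestRing.mon K m • ForestModule.u K τ}

/-- Pairs `(τ, μ)`, with `μ` a monomial in the variables `x_σ` with `σ < τ`. -/
abbrev ForestBasisIndex (S : Type*) [PartialOrder S] : Type _ :=
  {p : S × (NonMin S →₀ ℕ) // ∀ σ ∈ p.2.support, σ.1 < p.1}

/-! Vanishing comes from branching: if `σ` is not below `τ`, some cover `τ'` of `τ` is incomparable
to `σ`, so `x_σ u_τ = x_σ x_τ' u_τ' = 0`. Together with `x_τ u_τ = u_{τ₋}`, this rewrites each
monomial times `u_τ` as zero or as a proposed basis element (`mon_mem_annIdeal_or`).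

For independence, `M` is mapped to a vector space with one basis vector for each degree in a set
`IsDegree` containing all degrees of proposed basis elements. Monomials shift degrees, and a shift
leaving the set gives zero. This is an action of `R` because the set is convex (`IsDegree.convex`)
and a product of two incomparable variables always leaves it (`not_isDegree_add`). Distinct degrees
of the proposed basis elements then give independence, and reading coordinates gives the
annihilators.

For the negative results, the coordinate at the degree of `u_σ` vanishes on `Ann(x_σ²) M`, so `u_σ`
is not in that submodule. As `Ann x_σ ⊆ Ann x_σ²`, this gives `(Ann x_σ) M ≠ M`. Flatness applied to
`x_σ² u_σ = 0` would put `u_σ` in it. -/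

namespace IsBranchingForest

/-! ### Order theory of the forest. -/

variable {S : Type*} [PartialOrder S]

theorem exists_covBy (hS : IsBranchingForest S) (τ : NonMin S) : ∃ σ : S, σ ⋖ τ.1 := by
  obtain ⟨τ, hτ⟩ := τ
  obtain ⟨σ, hσ⟩ := not_isMin_iff.mp hτ
  have hfin : {ρ : S | ρ < τ}.Finite := (hS.finite_below τ).subset fun ρ hρ => le_of_lt hρ
  obtain ⟨μ, hμ⟩ := hfin.exists_maximal ⟨σ, hσ⟩
  exact ⟨μ, hμ.prop, fun ρ h₁ h₂ => (hμ.le_of_ge h₂ h₁.le).not_gt h₁⟩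

theorem le_of_lt_of_covBy (hS : IsBranchingForest S) {ρ σ τ : S} (h : σ ⋖ τ) (hρ : ρ < τ) :
    ρ ≤ σ := by
  rcases hS.total_below τ ρ σ hρ.le h.le with h' | h'
  · exact h'
  · rcases h'.eq_or_lt with h' | h'
    · exact h'.ge
    · exact absurd hρ (h.2 h')

theorem wellFoundedLT (hS : IsBranchingForest S) : WellFoundedLT S := by
  refine ⟨Subrelation.wf (r := InvImage (· < ·) fun τ : S => {σ : S | σ ≤ τ}.ncard)
    (fun {a b} h => ?_) (InvImage.wf _ wellFounded_lt)⟩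
  refine Set.ncard_lt_ncard ⟨fun ρ hρ => le_trans hρ h.le, fun h' => ?_⟩ (hS.finite_below b)
  exact h.not_ge (h' (le_refl b))

theorem _root_.CovBy.not_isMin {σ τ : S} (h : σ ⋖ τ) : ¬ IsMin τ :=
  not_isMin_iff.mpr ⟨σ, h.lt⟩

/-- Every element has two incomparable covers, as nonminimal elements. -/
theorem exists_covers (hS : IsBranchingForest S) (σ : S) :
    ∃ τ τ' : NonMin S, ¬ τ.1 ≤ τ'.1 ∧ ¬ τ'.1 ≤ τ.1 ∧ σ ⋖ τ.1 ∧ σ ⋖ τ'.1 := by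
  obtain ⟨τ, τ', h₁, h₂, h, h'⟩ := hS.branches σ
  exact ⟨⟨τ, h.not_isMin⟩, ⟨τ', h'.not_isMin⟩, h₁, h₂, h, h'⟩

/-- An element not below `τ` is incomparable to some cover of `τ`. -/
theorem exists_cover_incomparable (hS : IsBranchingForest S) {σ τ : S} (h : ¬ σ ≤ τ) :
    ∃ τ' : NonMin S, τ ⋖ τ'.1 ∧ ¬ σ ≤ τ'.1 ∧ ¬ τ'.1 ≤ σ := by
  have key : ∀ τ' : NonMin S, τ ⋖ τ'.1 → ¬ τ'.1 ≤ σ → ¬ σ ≤ τ'.1 := fun τ' hc hn hle =>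
    h (hS.le_of_lt_of_covBy hc (lt_of_le_of_ne hle fun e => hn e.ge))
  obtain ⟨τ₁, τ₂, h₁, h₂, c₁, c₂⟩ := hS.exists_covers τ
  -- The elements below `σ` form a chain, so `σ` lies above at most one of the two incomparable
  -- covers.
  by_cases h' : τ₁.1 ≤ σ
  · have h'' : ¬ τ₂.1 ≤ σ := fun h'' => (hS.total_below σ _ _ h' h'').elim h₁ h₂
    exact ⟨τ₂, c₂, key τ₂ c₂ h'', h''⟩
  · exact ⟨τ₁, c₁, key τ₁ c₁ h', h'⟩

end IsBranchingForest

/-! ### Monomials in `R`. -/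

namespace ForestRing

variable {K S : Type*} [Field K] [PartialOrder S]

theorem proj_surjective : Function.Surjective (proj K S) := Ideal.Quotient.mk_surjective

theorem proj_eq_zero_iff {f : MvPolynomial (NonMin S) K} :
    proj K S f = 0 ↔ f ∈ incompIdeal K S := Ideal.Quotient.eq_zero_iff_mem

theorem x_mul_x {σ τ : NonMin S} (h : ¬ σ.1 ≤ τ.1) (h' : ¬ τ.1 ≤ σ.1) : x K σ * x K τ = 0 := by
  rw [x, x, ← map_mul, proj_eq_zero_iff]
  exact Ideal.subset_span ⟨σ, τ, h, h', rfl⟩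

theorem mon_add (m m' : NonMin S →₀ ℕ) : mon K (m + m') = mon K m * mon K m' := by
  rw [mon, mon, mon, ← map_mul, MvPolynomial.monomial_mul, one_mul]

@[simp] theorem mon_zero : mon K (0 : NonMin S →₀ ℕ) = 1 := by
  rw [mon, MvPolynomial.monomial_zero', map_one, map_one]

theorem mon_single (σ : NonMin S) : mon K (Finsupp.single σ 1) = x K σ := rfl

theorem proj_eq_sum (f : MvPolynomial (NonMin S) K) :
    proj K S f = ∑ m ∈ f.support, f.coeff m • mon K m := by
  conv_lhs => rw [f.as_sum, map_sum]
  refine Finset.sum_congr rfl fun m _ => ?_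
  rw [mon, ← map_smul, MvPolynomial.smul_monomial, smul_eq_mul, mul_one]

/-- A variable dividing a monomial can be split off. -/
theorem exists_eq_single_add {σ : NonMin S} {m : NonMin S →₀ ℕ} (h : m σ ≠ 0) :
    ∃ m', m = Finsupp.single σ 1 + m' :=
  exists_add_of_le (Finsupp.single_le_iff.mpr (Nat.one_le_iff_ne_zero.mpr h))

/-- The ideal is generated by monomials, so membership is tested on each monomial of `f`; since `σ ≠
τ`, divisibility by `X_σ X_τ` means that both exponents are nonzero. -/
theorem mem_incompIdeal_iff {f : MvPolynomial (NonMin S) K} :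
    f ∈ incompIdeal K S ↔ ∀ m ∈ f.support, ∃ σ τ : NonMin S, ¬ σ.1 ≤ τ.1 ∧ ¬ τ.1 ≤ σ.1 ∧
      m σ ≠ 0 ∧ m τ ≠ 0 := by
  have h : incompIdeal K S = Ideal.span ((fun s => MvPolynomial.monomial s (1 : K)) ''
      {m | ∃ σ τ : NonMin S, ¬ σ.1 ≤ τ.1 ∧ ¬ τ.1 ≤ σ.1 ∧
        m = Finsupp.single σ 1 + Finsupp.single τ 1}) := by
    rw [incompIdeal]
    congr 1
    ext f
    constructor
    · rintro ⟨σ, τ, h₁, h₂, rfl⟩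
      exact ⟨_, ⟨σ, τ, h₁, h₂, rfl⟩, by simp [MvPolynomial.X, MvPolynomial.monomial_mul]⟩
    · rintro ⟨_, ⟨σ, τ, h₁, h₂, rfl⟩, rfl⟩
      exact ⟨σ, τ, h₁, h₂, by simp [MvPolynomial.X, MvPolynomial.monomial_mul]⟩
  rw [h, MvPolynomial.mem_ideal_span_monomial_image]
  refine forall₂_congr fun m _ => ⟨?_, ?_⟩
  · rintro ⟨_, ⟨σ, τ, h₁, h₂, rfl⟩, hle⟩
    have hσ := hle σ
    have hτ := hle τ
    simp only [Finsupp.add_apply, Finsupp.single_eq_same] at hσ hτ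
    exact ⟨σ, τ, h₁, h₂, by omega, by omega⟩
  · rintro ⟨σ, τ, h₁, h₂, hσ, hτ⟩
    have hne : σ ≠ τ := fun e => h₁ (e ▸ le_rfl)
    refine ⟨_, ⟨σ, τ, h₁, h₂, rfl⟩, fun ρ => ?_⟩
    rw [Finsupp.add_apply]
    rcases eq_or_ne ρ σ with rfl | h
    · rw [Finsupp.single_eq_same, Finsupp.single_eq_of_ne hne]
      omega
    · rw [Finsupp.single_eq_of_ne h, zero_add]
      rcases eq_or_ne ρ τ with rfl | h'
      · rw [Finsupp.single_eq_same]
        omega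
      · rw [Finsupp.single_eq_of_ne h']
        omega

end ForestRing

/-! ### Vanishing relations and the candidate annihilator. -/

namespace ForestModule

open ForestRing

variable {K S : Type*} [Field K] [PartialOrder S]

theorem x_smul_u {σ : S} {τ : NonMin S} (h : σ ⋖ τ.1) : x K τ • u K τ.1 = u K σ := by
  have : u K σ - x K τ • u K τ.1 = 0 := by
    rw [u, u, ← map_smul, ← map_sub]
    exact (Submodule.Quotient.mk_eq_zero _).mpr (Submodule.subset_span ⟨σ, τ, h, rfl⟩)
  exact (sub_eq_zero.mp this).symm

theorem span_range_u : Submodule.span (ForestRing K S) (Set.range (u K (S := S))) = ⊤ := by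
  have h : Set.range (u K (S := S)) =
      proj K S '' Set.range fun σ : S => Finsupp.single σ (1 : ForestRing K S) := by
    rw [← Set.range_comp]
    rfl
  rw [h, Submodule.span_image, ← Finsupp.coe_basisSingleOne, Module.Basis.span_eq,
    Submodule.map_top]
  exact Submodule.range_mkQ _

theorem x_smul_u_eq_zero (hS : IsBranchingForest S) {σ : NonMin S} {τ : S} (h : ¬ σ.1 ≤ τ) :
    x K σ • u K τ = 0 := by
  obtain ⟨τ', hc, h₁, h₂⟩ := hS.exists_cover_incomparable h
  rw [← x_smul_u hc, smul_smul, x_mul_x h₁ h₂, zero_smul]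

/-- One factor moves `u_σ` down to its predecessor, which does not lie above `σ`; the other factor
then kills it. -/
theorem x_sq_smul_u (hS : IsBranchingForest S) (σ : NonMin S) : x K σ ^ 2 • u K σ.1 = 0 := by
  obtain ⟨ρ, h⟩ := hS.exists_covBy σ
  rw [pow_two, mul_smul, x_smul_u h, x_smul_u_eq_zero hS h.lt.not_ge]

theorem prod_smul_u_eq_zero (hS : IsBranchingForest S) (n : ℕ) (t : Fin (n + 1) → NonMin S)
    (a : Fin (n + 1) → ℕ) (ht : ∀ i : Fin n, (t i.castSucc).1 ⋖ (t i.succ).1)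
    (ha : ∀ i, 1 ≤ a i) (h : ∃ i, 2 ≤ a i) :
    (∏ i, x K (t i) ^ a i) • u K (t (Fin.last n)).1 = 0 := by
  induction n with
  | zero =>
    obtain ⟨i, hi⟩ := h
    obtain rfl : i = Fin.last 0 := Fin.ext (by simp)
    rw [Fin.prod_univ_castSucc, Fin.prod_univ_zero, one_mul, ← Nat.sub_add_cancel hi, pow_add,
      mul_smul, x_sq_smul_u hS, smul_zero]
  | succ n ih =>
    rw [Fin.prod_univ_castSucc, mul_smul]
    by_cases hl : 2 ≤ a (Fin.last (n + 1))
    · rw [← Nat.sub_add_cancel hl, pow_add, mul_smul, x_sq_smul_u hS, smul_zero, smul_zero]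
    · have hl' : a (Fin.last (n + 1)) = 1 := by have := ha (Fin.last (n + 1)); omega
      rw [hl', pow_one, ← Fin.succ_last, x_smul_u (ht (Fin.last n))]
      refine ih (fun i => t i.castSucc) (fun i => a i.castSucc) (fun i => ht i.castSucc)
        (fun i => ha _) ?_
      obtain ⟨i, hi⟩ := h
      rcases Fin.eq_castSucc_or_eq_last i with ⟨j, rfl⟩ | rfl
      · exact ⟨j, hi⟩
      · exact absurd hi hl

theorem prod_smul_u (n : ℕ) {ρ : S} (t : Fin (n + 1) → NonMin S) (hρ : ρ ⋖ (t 0).1)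
    (ht : ∀ i : Fin n, (t i.castSucc).1 ⋖ (t i.succ).1) :
    (∏ i, x K (t i)) • u K (t (Fin.last n)).1 = u K ρ := by
  induction n with
  | zero =>
    rw [Fin.prod_univ_castSucc, Fin.prod_univ_zero, one_mul]
    exact x_smul_u hρ
  | succ n ih =>
    rw [Fin.prod_univ_castSucc, mul_smul, ← Fin.succ_last, x_smul_u (ht (Fin.last n))]
    exact ih (fun i => t i.castSucc) hρ fun i => ht i.castSucc

/-- The ideal generated by the variables not below `τ` and the products
`x_{τ_k} ^ 2 * x_{τ_{k+1}} * ⋯ * x_{τ_n}` along saturated chains ending in `τ_n = τ`. -/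
noncomputable def annIdeal (K : Type*) {S : Type*} [Field K] [PartialOrder S] (τ : S) :
    Ideal (ForestRing K S) :=
  Ideal.span
    ({f | ∃ σ : NonMin S, ¬ σ.1 ≤ τ ∧ f = ForestRing.x K σ} ∪
      {f | ∃ (n : ℕ) (t : Fin (n + 1) → NonMin S),
        (∀ i : Fin n, (t i.castSucc).1 ⋖ (t i.succ).1) ∧ (t (Fin.last n)).1 = τ ∧
        f = ForestRing.x K (t 0) ^ 2 * ∏ i : Fin n, ForestRing.x K (t i.succ)})

theorem annIdeal_le_torsionOf (hS : IsBranchingForest S) (τ : S) :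
    annIdeal K τ ≤ Ideal.torsionOf (ForestRing K S) (ForestModule K S) (u K τ) := by
  refine Ideal.span_le.mpr ?_
  rintro f (⟨σ, hσ, rfl⟩ | ⟨n, t, ht, rfl, rfl⟩)
  · exact x_smul_u_eq_zero hS hσ
  · refine (Ideal.mem_torsionOf_iff _ _).mpr ?_
    -- The exponents are `(2, 1, …, 1)`.
    have h := prod_smul_u_eq_zero (K := K) hS n t (Fin.cons 2 fun _ => 1) ht
      (fun i => by cases i using Fin.cases <;> simp) ⟨0, by simp⟩
    simpa [Fin.prod_univ_succ] using h

theorem x_mem_annIdeal {σ : NonMin S} {τ : S} (h : ¬ σ.1 ≤ τ) : x K σ ∈ annIdeal K τ :=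
  Ideal.subset_span (Or.inl ⟨σ, h, rfl⟩)

/-- Counterpart of `x_τ u_τ = u_σ` for the candidate annihilators. A variable not below `σ` is
either not below `τ` or equal to `x_τ`, giving the generator `x_τ²`; a chain ending in `σ` is
extended by `τ`. -/
theorem x_mul_mem_annIdeal (hS : IsBranchingForest S) {σ : S} {τ : NonMin S} (h : σ ⋖ τ.1)
    {f : ForestRing K S} (hf : f ∈ annIdeal K σ) : x K τ * f ∈ annIdeal K τ.1 := by
  have hle : annIdeal K σ ≤
      Submodule.comap (LinearMap.mulLeft (ForestRing K S) (x K τ)) (annIdeal K τ.1) := by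
    refine Submodule.span_le.mpr ?_
    rintro f (⟨ρ, hρ, rfl⟩ | ⟨n, t, ht, rfl, rfl⟩)
    · change x K τ * x K ρ ∈ annIdeal K τ.1
      by_cases hρτ : ρ.1 ≤ τ.1
      · obtain rfl : ρ = τ := by
          by_contra hne
          exact hρ (hS.le_of_lt_of_covBy h (lt_of_le_of_ne hρτ fun e => hne (Subtype.ext e)))
        refine Ideal.subset_span (Or.inr ⟨0, fun _ => ρ, fun i => i.elim0, rfl, ?_⟩)
        simp [pow_two]
      · exact Ideal.mul_mem_left _ _ (x_mem_annIdeal hρτ)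
    · refine Ideal.subset_span (Or.inr ⟨n + 1, Fin.snoc (α := fun _ => NonMin S) t τ,
        fun i => ?_, by simp, ?_⟩)
      · rcases Fin.eq_castSucc_or_eq_last i with ⟨j, rfl⟩ | rfl
        · rw [Fin.succ_castSucc, Fin.snoc_castSucc, Fin.snoc_castSucc]
          exact ht j
        · rw [Fin.succ_last, Fin.snoc_castSucc, Fin.snoc_last]
          exact h
      · have h0 : Fin.snoc (α := fun _ => NonMin S) t τ 0 = t 0 :=
          Fin.snoc_castSucc (α := fun _ => NonMin S) τ t 0
        rw [LinearMap.mulLeft_apply, Fin.prod_univ_castSucc, Fin.succ_last, Fin.snoc_last, h0]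
        simp_rw [Fin.succ_castSucc, Fin.snoc_castSucc]
        ring
  exact hle hf

end ForestModule

/-! ### Multidegrees. -/

namespace ForestModule

open ForestRing

variable {K S : Type*} [Field K] [PartialOrder S]

/-- The multidegree of the monomial `∏ x_σ ^ (m σ)`. -/
noncomputable def weight (m : NonMin S →₀ ℕ) : S →₀ ℤ :=
  m.sum fun σ n => Finsupp.single σ.1 (n : ℤ)

@[simp] theorem weight_zero : weight (0 : NonMin S →₀ ℕ) = 0 := Finsupp.sum_zero_index

theorem weight_add (m m' : NonMin S →₀ ℕ) : weight (m + m') = weight m + weight m' :=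
  Finsupp.sum_add_index' (by simp) (by simp)

theorem weight_single (σ : NonMin S) : weight (Finsupp.single σ 1) = Finsupp.single σ.1 1 := by
  simp [weight]

theorem weight_apply (m : NonMin S →₀ ℕ) (σ : NonMin S) : weight m σ.1 = m σ := by
  classical
  rw [weight, Finsupp.sum_apply, Finsupp.sum_eq_single σ]
  · simp
  · intro τ _ h
    exact Finsupp.single_eq_of_ne fun e => h (Subtype.ext e.symm)
  · simp

theorem weight_nonneg (m : NonMin S →₀ ℕ) (ρ : S) : 0 ≤ weight m ρ := by
  rw [weight, Finsupp.sum_apply]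
  refine Finset.sum_nonneg fun σ _ => ?_
  classical
  dsimp only
  rw [Finsupp.single_apply]
  split_ifs <;> simp

theorem exists_of_weight_ne_zero {m : NonMin S →₀ ℕ} {ρ : S} (h : weight m ρ ≠ 0) :
    ∃ σ ∈ m.support, σ.1 = ρ := by
  by_contra! hne
  refine h ?_
  rw [weight, Finsupp.sum_apply]
  exact Finset.sum_eq_zero fun σ hσ => Finsupp.single_eq_of_ne (hne σ hσ).symm

theorem weight_injective : Function.Injective (weight (S := S)) := by
  intro m m' h
  ext σ
  have := DFunLike.congr_fun h σ.1
  rwa [weight_apply, weight_apply, Nat.cast_inj] at this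

theorem multidegree_eq (m : NonMin S →₀ ℕ) (τ : S) :
    multidegree m τ = weight m + multidegree 0 τ := by
  simp [multidegree, weight, sub_eq_add_neg]

theorem multidegree_add (m m' : NonMin S →₀ ℕ) (τ : S) :
    multidegree (m + m') τ = multidegree m τ + weight m' := by
  rw [multidegree_eq, multidegree_eq m, weight_add]
  abel

theorem multidegree_left_injective (τ : S) :
    Function.Injective fun m : NonMin S →₀ ℕ => multidegree m τ := by
  intro m m' h
  simp only at h
  rw [multidegree_eq, multidegree_eq m'] at h
  exact weight_injective (add_right_cancel h)

open Classical in
theorem multidegree_zero_apply (hS : IsBranchingForest S) (τ ρ : S) :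
    multidegree 0 τ ρ = if ρ ≤ τ then -1 else 0 := by
  rw [multidegree, finsum_mem_eq_finite_toFinset_sum _ (hS.finite_below τ)]
  simp only [Finsupp.sum_zero_index, zero_sub, Finsupp.neg_apply, Finsupp.finsetSum_apply,
    Finsupp.single_apply, Finset.sum_ite_eq', Set.Finite.mem_toFinset, Set.mem_ofPred_eq]
  split_ifs <;> simp

/-- Homogeneity of the defining relations of `M`, needed for the degree map to descend to the
quotient. -/
theorem multidegree_zero_covBy (hS : IsBranchingForest S) {σ : S} {τ : NonMin S}
    (h : σ ⋖ τ.1) : multidegree (Finsupp.single τ 1) τ.1 = multidegree 0 σ := by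
  classical
  ext ρ
  rw [multidegree_eq, weight_single, Finsupp.add_apply, multidegree_zero_apply hS,
    multidegree_zero_apply hS, Finsupp.single_apply]
  rcases eq_or_ne ρ τ.1 with rfl | hne
  · simp [h.lt.not_ge]
  · have : ρ ≤ σ ↔ ρ ≤ τ.1 :=
      ⟨fun h' => h'.trans h.le, fun h' => hS.le_of_lt_of_covBy h (lt_of_le_of_ne h' hne)⟩
    simp [hne.symm, this]

theorem weight_eq_zero_of_not_lt {p : ForestBasisIndex S} {ρ : S} (h : ¬ ρ < p.1.1) :
    weight p.1.2 ρ = 0 := by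
  by_contra hne
  obtain ⟨σ, hσ, rfl⟩ := exists_of_weight_ne_zero hne
  exact h (p.2 σ hσ)

/-- The multidegrees which occur in the module. -/
def IsDegree (d : S →₀ ℤ) : Prop := ∃ τ, d τ < 0 ∧ ∀ ρ, d ρ ≠ 0 → ρ ≤ τ

/-- Only this inclusion is needed: `IsDegree` also admits degrees of no basis element, for instance
value `-2` at `τ` and zero elsewhere. -/
theorem isDegree_multidegree (hS : IsBranchingForest S) (p : ForestBasisIndex S) :
    IsDegree (multidegree p.1.2 p.1.1) := by
  classical
  refine ⟨p.1.1, ?_, fun ρ hρ => ?_⟩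
  · rw [multidegree_eq, Finsupp.add_apply, weight_eq_zero_of_not_lt (lt_irrefl _),
      multidegree_zero_apply hS]
    simp
  · by_contra hle
    rw [multidegree_eq, Finsupp.add_apply, weight_eq_zero_of_not_lt fun h => hle h.le,
      multidegree_zero_apply hS, if_neg hle] at hρ
    simp at hρ

theorem multidegree_injective (hS : IsBranchingForest S) :
    Function.Injective fun p : ForestBasisIndex S => multidegree p.1.2 p.1.1 := by
  classical
  -- The degree of `p` is `-1` at its own top element, whereas that of `q` vanishes outside the
  -- lower set of its top element.
  have key : ∀ p q : ForestBasisIndex S,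
      multidegree p.1.2 p.1.1 = multidegree q.1.2 q.1.1 → p.1.1 ≤ q.1.1 := by
    intro p q h
    by_contra hle
    have := DFunLike.congr_fun h p.1.1
    rw [multidegree_eq, multidegree_eq q.1.2, Finsupp.add_apply, Finsupp.add_apply,
      weight_eq_zero_of_not_lt (lt_irrefl _), weight_eq_zero_of_not_lt fun h => hle h.le,
      multidegree_zero_apply hS, multidegree_zero_apply hS, if_pos le_rfl, if_neg hle] at this
    simp at this
  rintro ⟨⟨τ, m⟩, hp⟩ ⟨⟨τ', m'⟩, hq⟩ h
  obtain rfl : τ = τ' := le_antisymm (key _ _ h) (key _ _ h.symm)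
  obtain rfl : m = m' := multidegree_left_injective τ h
  rfl

/-- Ensures that a shift which leaves the set cannot return. The negative coordinates of `d + weight
m` are negative for `d`, hence form a finite chain below `τ`, and `τ'` is one of them. Their maximum
`μ` is the witness: a nonzero coordinate not below `τ'` must be cancelled by `weight m' ≥ 0`, so it
is negative. -/
theorem IsDegree.convex (hS : IsBranchingForest S) {d : S →₀ ℤ} {m m' : NonMin S →₀ ℕ}
    (h : IsDegree d) (h' : IsDegree (d + weight m + weight m')) : IsDegree (d + weight m) := by
  obtain ⟨τ, hτ, hd⟩ := h
  obtain ⟨τ', hτ', hd'⟩ := h'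
  have hneg : ∀ ρ, (d + weight m) ρ ≠ 0 → ¬ ρ ≤ τ' → (d + weight m) ρ < 0 := by
    intro ρ hρ hle
    have h0 : (d + weight m + weight m') ρ = 0 := not_not.mp fun h => hle (hd' ρ h)
    rw [Finsupp.add_apply] at h0
    have := weight_nonneg m' ρ
    omega
  have hτ'neg : (d + weight m) τ' < 0 := by
    rw [Finsupp.add_apply] at hτ'
    have := weight_nonneg m' τ'
    omega
  have hle : ∀ ρ, (d + weight m) ρ < 0 → ρ ≤ τ := by
    intro ρ hρ
    rw [Finsupp.add_apply] at hρ
    have := weight_nonneg m ρ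
    exact hd ρ (by omega)
  have hfin : {ρ | (d + weight m) ρ < 0}.Finite := (hS.finite_below τ).subset hle
  obtain ⟨μ, hμ⟩ := hfin.exists_maximal ⟨τ', hτ'neg⟩
  have hmax : ∀ ρ, (d + weight m) ρ < 0 → ρ ≤ μ := by
    intro ρ hρ
    rcases hS.total_below τ ρ μ (hle ρ hρ) (hle μ hμ.prop) with h | h
    · exact h
    · exact hμ.le_of_ge hρ h
  refine ⟨μ, hμ.prop, fun ρ hρ => ?_⟩
  by_cases h : ρ ≤ τ'
  · exact h.trans (hmax τ' hτ'neg)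
  · exact hmax ρ (hneg ρ hρ h)

/-- Multiplication by monomials with incomparable variables leaves the set of degrees. -/
theorem not_isDegree_add (hS : IsBranchingForest S) {d : S →₀ ℤ} (h : IsDegree d)
    {m : NonMin S →₀ ℕ} {σ σ' : NonMin S} (h₁ : ¬ σ.1 ≤ σ'.1) (h₂ : ¬ σ'.1 ≤ σ.1)
    (hσ : m σ ≠ 0) (hσ' : m σ' ≠ 0) : ¬ IsDegree (d + weight m) := by
  obtain ⟨τ, hτ, hd⟩ := h
  rintro ⟨τ', hτ', hd'⟩
  have hle : τ' ≤ τ := by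
    refine hd τ' ?_
    rw [Finsupp.add_apply] at hτ'
    have := weight_nonneg m τ'
    omega
  -- Off the lower set of `τ` the degree `d` vanishes, so a variable there would make `d + weight m`
  -- nonzero, forcing `ρ ≤ τ' ≤ τ`.
  have key : ∀ ρ : NonMin S, m ρ ≠ 0 → ρ.1 ≤ τ := by
    intro ρ hρ
    by_contra hρτ
    have h0 : d ρ.1 = 0 := not_not.mp fun h => hρτ (hd _ h)
    refine hρτ ((hd' ρ.1 ?_).trans hle)
    rw [Finsupp.add_apply, weight_apply, h0]
    simpa using hρ
  exact (hS.total_below τ _ _ (key σ hσ) (key σ' hσ')).elim h₁ h₂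

/-! ### The model of `M` on which monomials shift degrees. -/

open Classical in
/-- The basis vector of degree `d`, or zero if `d` is not the degree of an element. -/
noncomputable def degreeVector (K : Type*) {S : Type*} [Field K] [PartialOrder S]
    (d : S →₀ ℤ) : {d : S →₀ ℤ // IsDegree d} →₀ K :=
  if h : IsDegree d then Finsupp.single ⟨d, h⟩ 1 else 0

/-- The operator which shifts degrees by the weight of a monomial. -/
noncomputable def shift (K : Type*) {S : Type*} [Field K] [PartialOrder S] (m : NonMin S →₀ ℕ) :
    Module.End K ({d : S →₀ ℤ // IsDegree d} →₀ K) :=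
  Finsupp.linearCombination K fun d => degreeVector K (d.1 + weight m)

theorem shift_single (m : NonMin S →₀ ℕ) (d : {d : S →₀ ℤ // IsDegree d}) :
    shift K m (Finsupp.single d 1) = degreeVector K (d.1 + weight m) := by
  rw [shift, Finsupp.linearCombination_single, one_smul]

theorem shift_degreeVector (m : NonMin S →₀ ℕ) {d : S →₀ ℤ} (h : IsDegree d) :
    shift K m (degreeVector K d) = degreeVector K (d + weight m) := by
  rw [degreeVector, dif_pos h, shift_single]

theorem shift_zero : shift K (0 : NonMin S →₀ ℕ) = 1 := by
  refine Finsupp.lhom_ext' fun d => LinearMap.ext_ring ?_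
  simp [shift_single, degreeVector, d.2]

theorem shift_add (hS : IsBranchingForest S) (m m' : NonMin S →₀ ℕ) :
    shift K (m + m') = shift K m * shift K m' := by
  refine Finsupp.lhom_ext' fun d => LinearMap.ext_ring ?_
  simp only [LinearMap.comp_apply, Finsupp.lsingle_apply, Module.End.mul_apply, shift_single]
  rw [add_comm m m', weight_add, ← add_assoc]
  by_cases h : IsDegree (d.1 + weight m')
  · rw [shift_degreeVector m h]
  · have h' : ¬ IsDegree (d.1 + weight m' + weight m) := fun h' => h (IsDegree.convex hS d.2 h')
    rw [degreeVector, degreeVector, dif_neg h, dif_neg h', map_zero]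

/-- The action of the polynomial ring by degree shifts. -/
noncomputable def shiftHom (K : Type*) {S : Type*} [Field K] [PartialOrder S]
    (hS : IsBranchingForest S) :
    MvPolynomial (NonMin S) K →ₐ[K] Module.End K ({d : S →₀ ℤ // IsDegree d} →₀ K) :=
  AddMonoidAlgebra.lift K _ (NonMin S →₀ ℕ)
    { toFun m := shift K m.toAdd
      map_one' := shift_zero
      map_mul' m m' := shift_add hS m.toAdd m'.toAdd }

theorem shiftHom_monomial (hS : IsBranchingForest S) (m : NonMin S →₀ ℕ) :
    shiftHom K hS (MvPolynomial.monomial m 1) = shift K m := by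
  refine (AddMonoidAlgebra.lift_single _ _ _).trans ?_
  rw [one_smul]
  rfl

theorem shiftHom_eq_zero (hS : IsBranchingForest S) {f : MvPolynomial (NonMin S) K}
    (hf : f ∈ incompIdeal K S) : shiftHom K hS f = 0 := by
  have hle : incompIdeal K S ≤ RingHom.ker (shiftHom K hS) := by
    refine Ideal.span_le.mpr ?_
    rintro f ⟨σ, τ, h₁, h₂, rfl⟩
    have hne : σ ≠ τ := fun e => h₁ (e ▸ le_rfl)
    rw [SetLike.mem_coe, RingHom.mem_ker, MvPolynomial.X, MvPolynomial.X,
      MvPolynomial.monomial_mul, one_mul, shiftHom_monomial]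
    refine Finsupp.lhom_ext' fun d => LinearMap.ext_ring ?_
    rw [LinearMap.comp_apply, Finsupp.lsingle_apply, shift_single, degreeVector,
      dif_neg (not_isDegree_add hS d.2 h₁ h₂ (by simp) (by simp))]
    rfl
  exact hle hf

/-- The action of `R` by degree shifts. -/
noncomputable def action (K : Type*) {S : Type*} [Field K] [PartialOrder S]
    (hS : IsBranchingForest S) :
    ForestRing K S →+* Module.End K ({d : S →₀ ℤ // IsDegree d} →₀ K) :=
  Ideal.Quotient.lift (incompIdeal K S) (shiftHom K hS : _ →+* _) fun _ hf =>
    shiftHom_eq_zero hS hf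

theorem action_proj (hS : IsBranchingForest S) (f : MvPolynomial (NonMin S) K) :
    action K hS (ForestRing.proj K S f) = shiftHom K hS f := rfl

theorem action_mon (hS : IsBranchingForest S) (m : NonMin S →₀ ℕ) :
    action K hS (mon K m) = shift K m := by
  rw [mon, action_proj, shiftHom_monomial]

/-- The module maps to a vector space with one basis vector in each degree. -/
theorem exists_degreeMap (K : Type*) {S : Type*} [Field K] [PartialOrder S]
    (hS : IsBranchingForest S) :
    ∃ φ : ForestModule K S →ₗ[K] ({d : S →₀ ℤ // IsDegree d} →₀ K),
      ∀ m τ, φ (mon K m • u K τ) = degreeVector K (multidegree m τ) := by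
  let _ : Module (ForestRing K S) ({d : S →₀ ℤ // IsDegree d} →₀ K) :=
    Module.compHom _ (action K hS)
  have hsmul : ∀ (r : ForestRing K S) (v : {d : S →₀ ℤ // IsDegree d} →₀ K),
    r • v = action K hS r v := fun _ _ => rfl
  have hbase : ∀ τ : S, IsDegree (multidegree 0 τ) := fun τ =>
    isDegree_multidegree hS ⟨(τ, 0), by simp⟩
  have hmon : ∀ (m : NonMin S →₀ ℕ) (τ : S), mon K m • degreeVector K (multidegree 0 τ) =
      degreeVector K (multidegree m τ) := fun m τ => by
    rw [hsmul, action_mon, shift_degreeVector m (hbase τ), multidegree_eq m, add_comm]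
  let ψ : (S →₀ ForestRing K S) →ₗ[ForestRing K S] ({d : S →₀ ℤ // IsDegree d} →₀ K) :=
    Finsupp.linearCombination _ fun τ => degreeVector K (multidegree 0 τ)
  have hψ : ∀ τ, ψ (Finsupp.single τ 1) = degreeVector K (multidegree 0 τ) := fun τ => by
    rw [Finsupp.linearCombination_single, one_smul]
  have hker : forestRelations K S ≤ LinearMap.ker ψ := by
    refine Submodule.span_le.mpr ?_
    rintro _ ⟨σ, τ, h, rfl⟩
    rw [SetLike.mem_coe, LinearMap.mem_ker, map_sub, map_smul, hψ, hψ, ← mon_single, hmon,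
      multidegree_zero_covBy hS h, sub_self]
  let φ : ForestModule K S →ₗ[ForestRing K S] ({d : S →₀ ℤ // IsDegree d} →₀ K) :=
    (forestRelations K S).liftQ ψ hker
  have hφ : ∀ τ, φ (u K τ) = degreeVector K (multidegree 0 τ) := hψ
  refine ⟨{ toFun := φ, map_add' := map_add φ, map_smul' := fun c y => ?_ }, fun m τ => ?_⟩
  · rw [← algebraMap_smul (ForestRing K S) c y, map_smul, hsmul]
    have : algebraMap K (ForestRing K S) c = ForestRing.proj K S (algebraMap K _ c) :=
      ((ForestRing.proj K S).commutes c).symm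
    rw [this, action_proj, AlgHom.commutes]
    rfl
  · exact (map_smul φ _ _).trans ((congrArg _ (hφ τ)).trans (hmon m τ))

end ForestModule

/-! ### The basis and the annihilators. -/

namespace ForestModule

open ForestRing

variable {K S : Type*} [Field K] [PartialOrder S]

/-- The elements `μ u_τ` with `μ` a monomial in the variables below `τ`. -/
noncomputable def basisVector (K : Type*) {S : Type*} [Field K] [PartialOrder S]
    (p : ForestBasisIndex S) : ForestModule K S :=
  mon K p.1.2 • u K p.1.1

/-- Induction on `τ`: a variable not below `τ` gives the first case, and a factor `x_τ` moves `u_τ`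
to its predecessor. Used both for spanning and for computing annihilators. -/
theorem mon_mem_annIdeal_or (hS : IsBranchingForest S) (τ : S) (m : NonMin S →₀ ℕ) :
    mon K m ∈ annIdeal K τ ∨ ∃ p : ForestBasisIndex S,
      multidegree p.1.2 p.1.1 = multidegree m τ ∧ mon K m • u K τ = basisVector K p := by
  have := hS.wellFoundedLT
  induction τ using WellFoundedLT.induction generalizing m with
  | ind τ ih =>
    by_cases hlt : ∀ σ ∈ m.support, σ.1 < τ
    · exact Or.inr ⟨⟨(τ, m), hlt⟩, rfl, rfl⟩
    · push Not at hlt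
      obtain ⟨σ, hσ, hστ⟩ := hlt
      obtain ⟨m', rfl⟩ := exists_eq_single_add (Finsupp.mem_support_iff.mp hσ)
      rw [mon_add, mon_single]
      by_cases hle : σ.1 ≤ τ
      · obtain rfl : σ.1 = τ := hle.eq_or_lt.resolve_right hστ
        obtain ⟨ρ, hρ⟩ := hS.exists_covBy σ
        refine (ih ρ hρ.lt m').imp (x_mul_mem_annIdeal hS hρ) ?_
        rintro ⟨p, hp, hp'⟩
        refine ⟨p, ?_, ?_⟩
        · rw [hp, multidegree_add, multidegree_zero_covBy hS hρ, multidegree_eq, add_comm]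
        · rw [mul_comm, mul_smul, x_smul_u hρ, hp']
      · exact Or.inl (Ideal.mul_mem_right _ _ (x_mem_annIdeal hle))

theorem degreeMap_basisVector (hS : IsBranchingForest S)
    {φ : ForestModule K S →ₗ[K] ({d : S →₀ ℤ // IsDegree d} →₀ K)}
    (hφ : ∀ m τ, φ (mon K m • u K τ) = degreeVector K (multidegree m τ))
    (p : ForestBasisIndex S) :
    φ (basisVector K p) = Finsupp.single ⟨_, isDegree_multidegree hS p⟩ 1 := by
  rw [basisVector, hφ, degreeVector, dif_pos (isDegree_multidegree hS p)]

theorem linearIndependent_basisVector (hS : IsBranchingForest S) :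
    LinearIndependent K (basisVector K (S := S)) := by
  obtain ⟨φ, hφ⟩ := exists_degreeMap K hS
  refine LinearIndependent.of_comp φ ?_
  have h := (Finsupp.basisSingleOne (R := K)
    (ι := {d : S →₀ ℤ // IsDegree d})).linearIndependent.comp
    (fun p : ForestBasisIndex S => ⟨_, isDegree_multidegree hS p⟩)
    fun p q h => multidegree_injective hS (congrArg Subtype.val h)
  convert h using 1
  ext1 p
  rw [Function.comp_apply, degreeMap_basisVector hS hφ, Function.comp_apply,
    Finsupp.coe_basisSingleOne]

theorem mon_smul_u_mem_span (hS : IsBranchingForest S) (m : NonMin S →₀ ℕ) (τ : S) :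
    mon K m • u K τ ∈ Submodule.span K (Set.range (basisVector K (S := S))) := by
  rcases mon_mem_annIdeal_or (K := K) hS τ m with h | ⟨p, -, hp⟩
  · rw [(Ideal.mem_torsionOf_iff _ _).mp (annIdeal_le_torsionOf hS τ h)]
    exact zero_mem _
  · rw [hp]
    exact Submodule.subset_span ⟨p, rfl⟩

theorem proj_smul_u (f : MvPolynomial (NonMin S) K) (τ : S) :
    ForestRing.proj K S f • u K τ = ∑ m ∈ f.support, f.coeff m • mon K m • u K τ := by
  rw [proj_eq_sum, Finset.sum_smul]
  exact Finset.sum_congr rfl fun m _ => smul_assoc _ _ _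

theorem span_basisVector (hS : IsBranchingForest S) :
    Submodule.span K (Set.range (basisVector K (S := S))) = ⊤ := by
  refine eq_top_iff.mpr fun y _ => ?_
  have hy : y ∈ Submodule.span (ForestRing K S) (Set.range (u K (S := S))) := by
    rw [span_range_u]
    exact Submodule.mem_top
  rw [Finsupp.mem_span_range_iff_exists_finsupp] at hy
  obtain ⟨c, rfl⟩ := hy
  refine Submodule.sum_mem _ fun τ _ => ?_
  obtain ⟨f, hf⟩ := proj_surjective (c τ)
  simp only [← hf, proj_smul_u]
  exact Submodule.sum_mem _ fun m _ => Submodule.smul_mem _ _ (mon_smul_u_mem_span hS m τ)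

/-- The `K`-basis of the module by the elements `μ u_τ`. -/
noncomputable def basis (K : Type*) {S : Type*} [Field K] [PartialOrder S]
    (hS : IsBranchingForest S) : Module.Basis (ForestBasisIndex S) K (ForestModule K S) :=
  Module.Basis.mk (linearIndependent_basisVector hS) (span_basisVector hS).ge

theorem basis_apply (hS : IsBranchingForest S) (p : ForestBasisIndex S) :
    basis K hS p = basisVector K p := Module.Basis.mk_apply _ _ _

theorem basisVector_mem_component_iff (hS : IsBranchingForest S) (p : ForestBasisIndex S)
    (d : S →₀ ℤ) : basisVector K p ∈ component K d ↔ d = multidegree p.1.2 p.1.1 := by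
  constructor
  · intro h
    obtain ⟨φ, hφ⟩ := exists_degreeMap K hS
    by_contra hne
    have hle : component K d ≤
        LinearMap.ker (Finsupp.lapply ⟨_, isDegree_multidegree hS p⟩ ∘ₗ φ) := by
      refine Submodule.span_le.mpr ?_
      rintro _ ⟨m, τ, hd, rfl⟩
      rw [SetLike.mem_coe, LinearMap.mem_ker, LinearMap.comp_apply, hφ, hd, Finsupp.lapply_apply,
        degreeVector]
      split_ifs
      · exact Finsupp.single_eq_of_ne fun e => hne (congrArg Subtype.val e).symm
      · rfl
    have h' := hle h
    rw [LinearMap.mem_ker, LinearMap.comp_apply, degreeMap_basisVector hS hφ,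
      Finsupp.lapply_apply, Finsupp.single_eq_same] at h'
    exact one_ne_zero h'
  · rintro rfl
    exact Submodule.subset_span ⟨_, _, rfl, rfl⟩

/-- For fixed `τ` distinct monomials have distinct degrees, so in `f u_τ = 0` each monomial outside
`annIdeal` has its own coordinate, and its coefficient is zero. -/
theorem torsionOf_u (hS : IsBranchingForest S) (τ : S) :
    Ideal.torsionOf (ForestRing K S) (ForestModule K S) (u K τ) = annIdeal K τ := by
  classical
  refine le_antisymm (fun r hr => ?_) (annIdeal_le_torsionOf hS τ)
  obtain ⟨φ, hφ⟩ := exists_degreeMap K hS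
  obtain ⟨f, rfl⟩ := proj_surjective r
  have hzero := congrArg φ ((Ideal.mem_torsionOf_iff _ _).mp hr)
  rw [proj_smul_u, map_sum, map_zero] at hzero
  rw [proj_eq_sum]
  refine Submodule.sum_mem _ fun m hm => ?_
  rcases mon_mem_annIdeal_or (K := K) hS τ m with h | ⟨p, hp, -⟩
  · rw [Algebra.smul_def]
    exact Ideal.mul_mem_left _ _ h
  · have hdeg : IsDegree (multidegree m τ) := hp ▸ isDegree_multidegree hS p
    have hcoeff := DFunLike.congr_fun hzero ⟨_, hdeg⟩
    rw [Finsupp.finsetSum_apply, Finset.sum_eq_single m] at hcoeff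
    · rw [map_smul, hφ, degreeVector, dif_pos hdeg, Finsupp.smul_apply, Finsupp.single_eq_same,
        smul_eq_mul, mul_one, Finsupp.zero_apply] at hcoeff
      rw [hcoeff, zero_smul]
      exact zero_mem _
    · intro m' _ hne
      rw [map_smul, hφ, degreeVector, Finsupp.smul_apply]
      split_ifs
      · rw [Finsupp.single_eq_of_ne, smul_zero]
        exact fun e => hne (multidegree_left_injective τ (congrArg Subtype.val e)).symm
      · exact smul_zero _
    · exact fun h => absurd hm h

/-! ### Products `IM` and failure of flatness. -/

theorem ideal_smul_top_eq_top {I : Ideal (ForestRing K S)}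
    (h : ∀ σ : S, ∃ τ : NonMin S, σ ⋖ τ.1 ∧ x K τ ∈ I) :
    I • (⊤ : Submodule (ForestRing K S) (ForestModule K S)) = ⊤ := by
  rw [eq_top_iff, ← span_range_u, Submodule.span_le]
  rintro _ ⟨σ, rfl⟩
  obtain ⟨τ, hστ, hτ⟩ := h σ
  rw [← x_smul_u hστ]
  exact Submodule.smul_mem_smul hτ (Submodule.subset_span ⟨τ.1, rfl⟩)

theorem prime_smul_top (hS : IsBranchingForest S) {P : Ideal (ForestRing K S)} (hP : P.IsPrime) :
    P • (⊤ : Submodule (ForestRing K S) (ForestModule K S)) = ⊤ := by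
  refine ideal_smul_top_eq_top fun σ => ?_
  obtain ⟨τ, τ', h₁, h₂, c, c'⟩ := hS.exists_covers σ
  have h0 : x K τ * x K τ' ∈ P := by
    rw [x_mul_x h₁ h₂]
    exact zero_mem _
  exact (hP.mem_or_mem h0).elim (fun h => ⟨τ, c, h⟩) fun h => ⟨τ', c', h⟩

theorem torsionOf_u_smul_top (hS : IsBranchingForest S) (σ : S) :
    Ideal.torsionOf (ForestRing K S) (ForestModule K S) (u K σ) •
      (⊤ : Submodule (ForestRing K S) (ForestModule K S)) = ⊤ := by
  refine ideal_smul_top_eq_top fun ρ => ?_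
  obtain ⟨τ, τ', h₁, h₂, c, c'⟩ := hS.exists_covers ρ
  by_cases h : τ.1 ≤ σ
  · exact ⟨τ', c', x_smul_u_eq_zero hS fun h' => (hS.total_below σ _ _ h h').elim h₁ h₂⟩
  · exact ⟨τ, c, x_smul_u_eq_zero hS h⟩

/-- The degree of `u_σ` does not occur in the product of `u_τ` with an annihilator of
`x_σ ^ 2`. -/
theorem multidegree_ne_of_proj_mul_x_sq (hS : IsBranchingForest S) {σ : NonMin S}
    {f : MvPolynomial (NonMin S) K} (hf : x K σ ^ 2 * ForestRing.proj K S f = 0)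
    {m : NonMin S →₀ ℕ} (hm : m ∈ f.support) (τ : S) :
    multidegree m τ ≠ multidegree 0 σ.1 := by
  classical
  intro hdeg
  have hcoord : ∀ ρ : S, weight m ρ + (if ρ ≤ τ then -1 else 0) = if ρ ≤ σ.1 then -1 else 0 := by
    intro ρ
    rw [← multidegree_zero_apply hS, ← multidegree_zero_apply hS, ← hdeg, multidegree_eq m,
      Finsupp.add_apply]
  have hσ : σ.1 ≤ τ := by
    by_contra h
    have := hcoord σ.1
    have := weight_nonneg m σ.1
    rw [if_neg h, if_pos le_rfl] at *
    omega
  -- At `ρ` not below `τ` the left side of `hcoord` is `m ρ > 0`, the right side at most `0`.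
  have hvar : ∀ ρ : NonMin S, m ρ ≠ 0 → ρ.1 ≤ τ := by
    intro ρ hρ
    by_contra h
    have := hcoord ρ.1
    rw [if_neg h, weight_apply] at this
    split_ifs at this <;> omega
  -- Hence `m + 2σ` must involve two incomparable variables, yet all its variables lie in the chain
  -- below `τ`.
  have hmem : f * MvPolynomial.monomial (Finsupp.single σ 2) 1 ∈ incompIdeal K S := by
    rw [← proj_eq_zero_iff, map_mul, mul_comm, ← hf, x, ← map_pow, MvPolynomial.X,
      MvPolynomial.monomial_pow]
    simp
  rw [mem_incompIdeal_iff] at hmem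
  obtain ⟨ρ, ρ', h₁, h₂, hρ, hρ'⟩ := hmem (m + Finsupp.single σ 2) (by
    rw [MvPolynomial.mem_support_iff, MvPolynomial.coeff_mul_monomial, mul_one]
    exact MvPolynomial.mem_support_iff.mp hm)
  have hle : ∀ ρ : NonMin S, (m + Finsupp.single σ 2 : NonMin S →₀ ℕ) ρ ≠ 0 → ρ.1 ≤ τ := by
    intro ρ hρ
    rcases eq_or_ne ρ σ with rfl | hne
    · exact hσ
    · rw [Finsupp.add_apply, Finsupp.single_eq_of_ne hne, add_zero] at hρ
      exact hvar ρ hρ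
  exact (hS.total_below τ _ _ (hle ρ hρ) (hle ρ' hρ')).elim h₁ h₂

/-- Stated for `x_σ²` rather than `x_σ` so as to serve the non-flatness as well. -/
theorem u_notMem_torsionOf_smul_top (hS : IsBranchingForest S) (σ : NonMin S) :
    u K σ.1 ∉ Ideal.torsionOf (ForestRing K S) (ForestRing K S) (x K σ ^ 2) •
      (⊤ : Submodule (ForestRing K S) (ForestModule K S)) := by
  intro hmem
  obtain ⟨φ, hφ⟩ := exists_degreeMap K hS
  let p : ForestBasisIndex S := ⟨(σ.1, 0), by simp⟩
  have hp : u K σ.1 = basisVector K p := by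
    rw [basisVector, mon_zero, one_smul]
  let ψ : ForestModule K S →ₗ[K] K := Finsupp.lapply ⟨_, isDegree_multidegree hS p⟩ ∘ₗ φ
  have hψu : ψ (u K σ.1) = 1 := by
    rw [hp, LinearMap.comp_apply, degreeMap_basisVector hS hφ, Finsupp.lapply_apply,
      Finsupp.single_eq_same]
  have hgen : ∀ r : ForestRing K S, x K σ ^ 2 * r = 0 → ∀ τ, ψ (r • u K τ) = 0 := by
    intro r hr τ
    obtain ⟨f, rfl⟩ := proj_surjective r
    rw [proj_smul_u, map_sum]
    refine Finset.sum_eq_zero fun m hm => ?_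
    rw [map_smul, LinearMap.comp_apply, hφ, Finsupp.lapply_apply, degreeVector]
    split_ifs
    · rw [Finsupp.single_eq_of_ne, smul_zero]
      exact fun e =>
        multidegree_ne_of_proj_mul_x_sq hS hr hm τ (congrArg Subtype.val e).symm
    · exact smul_zero _
  have hzero : ∀ r : ForestRing K S, x K σ ^ 2 * r = 0 → ∀ y : ForestModule K S,
      ψ (r • y) = 0 := by
    intro r hr y
    have hy : y ∈ Submodule.span (ForestRing K S) (Set.range (u K (S := S))) := by
      rw [span_range_u]
      exact Submodule.mem_top
    rw [Finsupp.mem_span_range_iff_exists_finsupp] at hy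
    obtain ⟨c, rfl⟩ := hy
    rw [Finsupp.sum, Finset.smul_sum, map_sum]
    refine Finset.sum_eq_zero fun τ _ => ?_
    rw [smul_smul]
    exact hgen _ (by rw [← mul_assoc, hr, zero_mul]) τ
  have hψ0 : ψ (u K σ.1) = 0 := by
    refine Submodule.smul_induction_on hmem (fun r hr y _ => hzero r ?_ y) fun y z hy hz => ?_
    · rw [mul_comm]
      exact hr
    · rw [map_add, hy, hz, add_zero]
  exact one_ne_zero (hψu.symm.trans hψ0)

theorem torsionOf_x_smul_top_ne_top (hS : IsBranchingForest S) (σ : NonMin S) :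
    Ideal.torsionOf (ForestRing K S) (ForestRing K S) (x K σ) •
      (⊤ : Submodule (ForestRing K S) (ForestModule K S)) ≠ ⊤ := by
  intro h
  refine u_notMem_torsionOf_smul_top (K := K) hS σ (Submodule.smul_mono_left ?_
    (h ▸ Submodule.mem_top : u K σ.1 ∈ _))
  intro r hr
  have hr' : r * x K σ = 0 := hr
  change r * x K σ ^ 2 = 0
  rw [pow_two, ← mul_assoc, hr', zero_mul]

theorem not_flat (hS : IsBranchingForest S) :
    ¬ Module.Flat (ForestRing K S) (ForestModule K S) := by
  intro _
  obtain ⟨ρ⟩ := hS.nonempty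
  obtain ⟨σ, -⟩ := hS.exists_covers ρ
  -- The equational criterion for the relation `x_σ² u_σ = 0` writes `u_σ = ∑ a_j y_j` with every
  -- `a_j` annihilating `x_σ²`.
  obtain ⟨k, a, y, hy, ha⟩ := Module.Flat.isTrivialRelation_of_sum_smul_eq_zero
    (f := fun _ : Unit => x K σ ^ 2) (x := fun _ => u K σ.1)
    (by simpa using x_sq_smul_u hS σ)
  refine u_notMem_torsionOf_smul_top (K := K) hS σ ?_
  rw [show u K σ.1 = ∑ j, a () j • y j from hy ()]
  refine Submodule.sum_mem _ fun j _ => Submodule.smul_mem_smul ?_ Submodule.mem_top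
  change a () j * x K σ ^ 2 = 0
  rw [mul_comm]
  simpa using ha j

end ForestModule

theorem mainTheorem4 (K S : Type*) [Field K] [PartialOrder S] (hS : IsBranchingForest S) :
    -- (a) vanishing of products
    ((∀ (σ : NonMin S) (τ : S), ¬ σ.1 ≤ τ → ForestRing.x K σ • ForestModule.u K τ = 0) ∧
      (∀ σ : NonMin S, ForestRing.x K σ ^ 2 • ForestModule.u K σ.1 = 0)) ∧
    -- (b) products along a saturated chain ρ ⋖ t 0 ⋖ ... ⋖ t n
    (∀ (n : ℕ) (ρ : S) (t : Fin (n + 1) → NonMin S) (a : Fin (n + 1) → ℕ),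
      ρ ⋖ (t 0).1 → (∀ i : Fin n, (t i.castSucc).1 ⋖ (t i.succ).1) → (∀ i, 1 ≤ a i) →
      ((∃ i, 2 ≤ a i) →
        (∏ i, ForestRing.x K (t i) ^ a i) • ForestModule.u K (t (Fin.last n)).1 = 0) ∧
      ((∀ i, a i = 1) →
        (∏ i, ForestRing.x K (t i) ^ a i) • ForestModule.u K (t (Fin.last n)).1 =
          ForestModule.u K ρ)) ∧
    -- (c) the annihilator of each generator
    (∀ τ : S, Ideal.torsionOf (ForestRing K S) (ForestModule K S) (ForestModule.u K τ) =
      Ideal.span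
        ({f | ∃ σ : NonMin S, ¬ σ.1 ≤ τ ∧ f = ForestRing.x K σ} ∪
          {f | ∃ (n : ℕ) (t : Fin (n + 1) → NonMin S),
            (∀ i : Fin n, (t i.castSucc).1 ⋖ (t i.succ).1) ∧ (t (Fin.last n)).1 = τ ∧
            f = ForestRing.x K (t 0) ^ 2 * ∏ i : Fin n, ForestRing.x K (t i.succ)})) ∧
    -- (d) a multihomogeneous basis with distinct multidegrees
    (∃ b : Module.Basis (ForestBasisIndex S) K (ForestModule K S),
      (∀ p, b p = ForestRing.mon K p.1.2 • ForestModule.u K p.1.1) ∧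
      (∀ p d, b p ∈ ForestModule.component K d ↔ d = multidegree p.1.2 p.1.1) ∧
      Function.Injective fun p : ForestBasisIndex S => multidegree p.1.2 p.1.1) ∧
    -- (e) M = PM for minimal primes P, and products with annihilators
    ((∀ P ∈ minimalPrimes (ForestRing K S),
        P • (⊤ : Submodule (ForestRing K S) (ForestModule K S)) = ⊤) ∧
      (∀ σ : S, Ideal.torsionOf (ForestRing K S) (ForestModule K S) (ForestModule.u K σ) •
        (⊤ : Submodule (ForestRing K S) (ForestModule K S)) = ⊤) ∧
      (∀ σ : NonMin S, Ideal.torsionOf (ForestRing K S) (ForestRing K S) (ForestRing.x K σ) •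
        (⊤ : Submodule (ForestRing K S) (ForestModule K S)) ≠ ⊤)) ∧
    -- (f) M is not flat
    ¬ Module.Flat (ForestRing K S) (ForestModule K S) := by
  refine ⟨⟨fun σ τ h => ForestModule.x_smul_u_eq_zero hS h, ForestModule.x_sq_smul_u hS⟩,
    fun n ρ t a hρ ht ha => ⟨ForestModule.prod_smul_u_eq_zero hS n t a ht ha, fun h => ?_⟩,
    ForestModule.torsionOf_u hS,
    ⟨ForestModule.basis K hS, ForestModule.basis_apply hS, fun p d => ?_,
      ForestModule.multidegree_injective hS⟩,
    ⟨fun P hP => ForestModule.prime_smul_top hS hP.1.1, ForestModule.torsionOf_u_smul_top hS,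
      ForestModule.torsionOf_x_smul_top_ne_top hS⟩, ForestModule.not_flat hS⟩
  · simp_rw [h, pow_one]
    exact ForestModule.prod_smul_u n t hρ ht
  · rw [ForestModule.basis_apply]
    exact ForestModule.basisVector_mem_component_iff hS p d
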